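/- Theorem. Fix a field $K$ and a finite quiver $Q$. A quiver over $Q$ is a finite quiver $Q'$ with a morphism of quivers $f'\colon Q'\to Q$; morphisms are morphisms of quivers commuting with the structure maps to $Q$. Let $\mathcal{C}$ be a full subcategory of the category of quivers over $Q$ such that: 1. $\mathcal{C}$ is acyclic: its only endomorphisms are identities and only identities are invertible; and for every object $x$ of $\mathcal C$ there are only finitely many objects $z$ of $\mathcal C$ admitting a morphism $z\to x$ (for instance, $\mathcal{C}$ has finitely many objects); 2. every object $(Q',f')$ of $\mathcal{C}$ is connected (as a quiver) and a wrapping, i.e. for all vertices $i',j'$ of $Q'$ the map $f'$ is injective on the set of arrows from $i'$ to $j'$; 3. $\mathcal{C}$ is closed under fiber products: for all $x,y\in\mathcal{C}$ the fiber product $x\times_Q y$ is isomorphic over $Q$ to a finite (possibly empty) disjoint union of objects of $\mathcal{C}$; 4. for each object $x=(Q',f')$ of $\mathcal{C}$ the linearization $L(x)=f'_*\mathbb{1}_{Q'}$ is an indecomposable representation of $Q$ over $K$, and $L(x)\not\simeq L(y)$ for distinct objects $x\neq y$ of $\mathcal{C}$. Here $\mathbb{1}_{Q'}$ has $K$ at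 each vertex and the identity over each arrow, and the pushforward $f'_*V$ has the space $\bigoplus_{f'(i)=a}V_i$ at a vertex $a$ of $Q$ and, over an arrow $\alpha$ of $Q$, the sum of the maps of $V$ over all arrows $\beta$ with $f'(\beta)=\alpha$. Let $R(Q)$ be the representation ring: the free abelian group on isomorphism classes of finite-dimensional representations of $Q$ over $K$ modulo the relations $[V\oplus W]=[V]+[W]$, with product induced by the pointwise tensor product. Let $M(\mathcal{C})$ be the Möbius ring of $\mathcal{C}$: the free abelian group on the objects of $\mathcal{C}$, with the product for which the elements $\delta_x=\sum_z\mu(z,x)\,z$ (which form a $\mathbb{Z}$-basis) are orthogonal idempotents, where $\mu$ is the Möbius function of $\mathcal C$, determined by $\mu(x,y)=0$ if there is no morphism $x\to y$, and $\sum_z|\mathrm{Hom}(x,z)|\,\mu(z,y)=1$ if $x=y$ and $=0$ if $x\ne y$. Rings and subrings are not required to contain an identity element. Then the additive extension $L\colon M(\mathcal{C})\to R(Q)$ of $x\mapsto[L(x)]$ is an injective ring homomorphism, and it is an isomorphism of $M(\mathcal{C})$ onto the subring of $R(Q)$ generated by $L(\mathcal{C})=\{[L(x)] : x\in\mathcal{C}\}$.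 -/

import Mathlib

open CategoryTheory
open scoped TensorProduct

universe u v w

/-! ### Finite quivers and quivers over a quiver -/

/-- A finite quiver: finite sets of vertices and arrows, with start and terminal vertex maps. -/
structure FinQuiver : Type (u + 1) where
  /-- vertices -/
  V : Type u
  /-- arrows -/
  E : Type u
  /-- start vertex -/
  s : E → V
  /-- terminal vertex -/
  t : E → V
  [finV : Finite V]
  [finE : Finite E]

attribute [instance] FinQuiver.finV FinQuiver.finE

/-- Morphisms of quivers. -/
@[ext]
structure FinQuiver.Hom (A B : FinQuiver.{u}) : Type u where
  /-- action on vertices -/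
  onV : A.V → B.V
  /-- action on arrows -/
  onE : A.E → B.E
  s_onE : ∀ a, B.s (onE a) = onV (A.s a)
  t_onE : ∀ a, B.t (onE a) = onV (A.t a)

/-- A quiver is connected if it is nonempty and any two vertices are joined by an unoriented
path. -/
def FinQuiver.IsConnected (A : FinQuiver.{u}) : Prop :=
  Nonempty A.V ∧
    ∀ i j : A.V, Relation.EqvGen (fun p q => ∃ a : A.E, A.s a = p ∧ A.t a = q) i j

/-- A morphism of quivers is a wrapping if for any two vertices `i`, `j` of the source it is
injective on the set of arrows from `i` to `j`. -/
def FinQuiver.Hom.IsWrapping {A B : FinQuiver.{u}} (f : FinQuiver.Hom A B) : Prop :=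
  ∀ i j : A.V, Set.InjOn f.onE {a | A.s a = i ∧ A.t a = j}

/-- A (finite) quiver over `Q`. -/
structure QuiverOver (Q : FinQuiver.{u}) : Type (u + 1) where
  /-- the underlying quiver -/
  quiver : FinQuiver.{u}
  /-- the structure map -/
  str : FinQuiver.Hom quiver Q

/-- Morphisms of quivers over `Q`: morphisms of quivers commuting with the structure maps. -/
@[ext]
structure QuiverOver.Hom {Q : FinQuiver.{u}} (X Y : QuiverOver Q) : Type u where
  /-- the underlying morphism of quivers -/
  map : FinQuiver.Hom X.quiver Y.quiver
  str_onV : ∀ i, Y.str.onV (map.onV i) = X.str.onV i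
  str_onE : ∀ a, Y.str.onE (map.onE a) = X.str.onE a

/-- The category of quivers over `Q`. -/
instance QuiverOver.instCategory (Q : FinQuiver.{u}) : Category.{u} (QuiverOver Q) where
  Hom X Y := QuiverOver.Hom X Y
  id X :=
    { map := { onV := id, onE := id, s_onE := fun _ => rfl, t_onE := fun _ => rfl }
      str_onV := fun _ => rfl
      str_onE := fun _ => rfl }
  comp f g :=
    { map :=
        { onV := g.map.onV ∘ f.map.onV
          onE := g.map.onE ∘ f.map.onE
          s_onE := fun a => by simp [g.map.s_onE, f.map.s_onE]
          t_onE := fun a => by simp [g.map.t_onE, f.map.t_onE] }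
      str_onV := fun i => by simp [g.str_onV, f.str_onV]
      str_onE := fun a => by simp [g.str_onE, f.str_onE] }

/-- There are only finitely many morphisms between two (finite) quivers over `Q`. -/
instance QuiverOver.finite_hom {Q : FinQuiver.{u}} (X Y : QuiverOver Q) : Finite (X ⟶ Y) := by
  refine Finite.of_injective
    (β := (X.quiver.V → Y.quiver.V) × (X.quiver.E → Y.quiver.E))
    (fun f => ((show QuiverOver.Hom X Y from f).map.onV,
      (show QuiverOver.Hom X Y from f).map.onE)) ?_
  intro f g h
  simp only [Prod.mk.injEq] at h
  exact QuiverOver.Hom.ext (FinQuiver.Hom.ext h.1 h.2)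

instance QuiverOver.finite_hom_full {Q : FinQuiver.{u}} (C : ObjectProperty (QuiverOver Q))
    (X Y : C.FullSubcategory) : Finite (X ⟶ Y) :=
  Finite.of_injective (fun f : X ⟶ Y => f.hom) fun _ _ h => ObjectProperty.hom_ext C h

/-- The fiber product of two quivers over `Q`. -/
def QuiverOver.fiberProduct {Q : FinQuiver.{u}} (X Y : QuiverOver Q) : QuiverOver Q where
  quiver :=
    { V := {p : X.quiver.V × Y.quiver.V // X.str.onV p.1 = Y.str.onV p.2}
      E := {a : X.quiver.E × Y.quiver.E // X.str.onE a.1 = Y.str.onE a.2}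
      s := fun a => ⟨(X.quiver.s a.1.1, Y.quiver.s a.1.2), by
        rw [← X.str.s_onE, ← Y.str.s_onE, a.2]⟩
      t := fun a => ⟨(X.quiver.t a.1.1, Y.quiver.t a.1.2), by
        rw [← X.str.t_onE, ← Y.str.t_onE, a.2]⟩ }
  str :=
    { onV := fun p => X.str.onV p.1.1
      onE := fun a => X.str.onE a.1.1
      s_onE := fun a => X.str.s_onE a.1.1
      t_onE := fun a => X.str.t_onE a.1.1 }

/-- The disjoint union of a finite family of quivers over `Q`. -/
def QuiverOver.disjointUnion {Q : FinQuiver.{u}} {n : ℕ} (w : Fin n → QuiverOver Q) :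
    QuiverOver Q where
  quiver :=
    { V := Σ i, (w i).quiver.V
      E := Σ i, (w i).quiver.E
      s := fun a => ⟨a.1, (w a.1).quiver.s a.2⟩
      t := fun a => ⟨a.1, (w a.1).quiver.t a.2⟩ }
  str :=
    { onV := fun p => (w p.1).str.onV p.2
      onE := fun a => (w a.1).str.onE a.2
      s_onE := fun a => (w a.1).str.s_onE a.2
      t_onE := fun a => (w a.1).str.t_onE a.2 }

/-- A full subcategory of the category of quivers over `Q`, given by its class `C` of objects, is
closed under fiber products if the fiber product of any two of its objects is (isomorphic over `Q`
to) a finite, possibly empty, disjoint union of objects of `C`. -/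
def ClosedUnderFiberProducts {Q : FinQuiver.{u}} (C : ObjectProperty (QuiverOver Q)) : Prop :=
  ∀ X Y : QuiverOver Q, C X → C Y →
    ∃ (n : ℕ) (w : Fin n → QuiverOver Q), (∀ i, C (w i)) ∧
      Nonempty (X.fiberProduct Y ≅ QuiverOver.disjointUnion w)

/-! ### Representations of quivers -/

/-- A finite-dimensional representation of `Q` over `K`. -/
structure QuiverRep (K : Type u) [Field K] (Q : FinQuiver.{u}) : Type (u + 1) where
  /-- the vector space at a vertex -/
  obj : Q.V → Type u
  [addCommGroup : ∀ x, AddCommGroup (obj x)]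
  [module : ∀ x, Module K (obj x)]
  [finite : ∀ x, Module.Finite K (obj x)]
  /-- the linear map over an arrow -/
  map : ∀ a : Q.E, obj (Q.s a) →ₗ[K] obj (Q.t a)

attribute [instance] QuiverRep.addCommGroup QuiverRep.module QuiverRep.finite

namespace QuiverRep

variable {K : Type u} [Field K] {Q : FinQuiver.{u}}

/-- Isomorphisms of representations. -/
structure Iso (A B : QuiverRep K Q) : Type u where
  /-- the linear isomorphism at a vertex -/
  equiv : ∀ x, A.obj x ≃ₗ[K] B.obj x
  comm : ∀ (a : Q.E) (m : A.obj (Q.s a)),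
    equiv (Q.t a) (A.map a m) = B.map a (equiv (Q.s a) m)

/-- The identity isomorphism. -/
def Iso.refl (A : QuiverRep K Q) : Iso A A where
  equiv _ := LinearEquiv.refl K _
  comm _ _ := rfl

/-- The inverse isomorphism. -/
def Iso.symm {A B : QuiverRep K Q} (e : Iso A B) : Iso B A where
  equiv x := (e.equiv x).symm
  comm a m := by
    rw [LinearEquiv.symm_apply_eq, e.comm, LinearEquiv.apply_symm_apply]

/-- Composition of isomorphisms. -/
def Iso.trans {A B D : QuiverRep K Q} (e : Iso A B) (f : Iso B D) : Iso A D where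
  equiv x := (e.equiv x).trans (f.equiv x)
  comm a m := by simp [e.comm, f.comm]

/-- Two representations are isomorphic. -/
def IsIsomorphic (A B : QuiverRep K Q) : Prop := Nonempty (Iso A B)

/-- The direct sum of two representations. -/
def directSum (A B : QuiverRep K Q) : QuiverRep K Q where
  obj x := A.obj x × B.obj x
  map a := (A.map a).prodMap (B.map a)

/-- The (pointwise) tensor product of two representations. -/
def tensor (A B : QuiverRep K Q) : QuiverRep K Q where
  obj x := A.obj x ⊗[K] B.obj x
  map a := TensorProduct.map (A.map a) (B.map a)

variable (K Q) in
/-- The identity representation: `K` at each vertex, the identity over each arrow. -/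
def identityRep : QuiverRep K Q where
  obj _ := K
  map _ := LinearMap.id

/-- A representation is zero if all its vector spaces are. -/
def IsZero (A : QuiverRep K Q) : Prop := ∀ x, Subsingleton (A.obj x)

/-- A representation is indecomposable if it is nonzero and is not isomorphic to a direct sum of
two nonzero representations. -/
def IsIndecomposable (A : QuiverRep K Q) : Prop :=
  ¬ A.IsZero ∧ ∀ B D : QuiverRep K Q, A.IsIsomorphic (B.directSum D) → B.IsZero ∨ D.IsZero

open Classical in
/-- The map over an arrow `a` of the pushforward: the sum of the maps over the (finitely many)
arrows lying over `a`, each extended by zero to the direct sum. -/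
noncomputable def pushforwardMap {P : FinQuiver.{u}} (f : FinQuiver.Hom P Q) (A : QuiverRep K P)
    (a : Q.E) :
    (∀ y : {y : P.V // f.onV y = Q.s a}, A.obj y.1) →ₗ[K]
      (∀ y : {y : P.V // f.onV y = Q.t a}, A.obj y.1) :=
  ∑ᶠ b : {b : P.E // f.onE b = a},
    LinearMap.single K (fun y : {y : P.V // f.onV y = Q.t a} => A.obj y.1)
        ⟨P.t b.1, by rw [← f.t_onE, b.2]⟩ ∘ₗ
      A.map b.1 ∘ₗ
        LinearMap.proj (φ := fun y : {y : P.V // f.onV y = Q.s a} => A.obj y.1)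
          ⟨P.s b.1, by rw [← f.s_onE, b.2]⟩

/-- The pushforward of a representation of `P` along a morphism of quivers `f : P → Q`: the space
at `x` is the (finite) direct sum of the spaces at the vertices over `x`, and the map over an arrow
`a` is the sum of the maps over the arrows lying over `a`. -/
noncomputable def pushforward {P : FinQuiver.{u}} (f : FinQuiver.Hom P Q) (A : QuiverRep K P) :
    QuiverRep K Q where
  obj x := ∀ y : {y : P.V // f.onV y = x}, A.obj y.1
  map a := pushforwardMap f A a

end QuiverRep

/-- The linearization of a quiver over `Q`: the pushforward of the identity representation along
the structure map. -/
noncomputable def QuiverOver.linearization (K : Type u) [Field K] {Q : FinQuiver.{u}}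
    (X : QuiverOver Q) : QuiverRep K Q :=
  QuiverRep.pushforward X.str (QuiverRep.identityRep K X.quiver)

/-! ### The representation ring -/

/-- Isomorphism of representations as an equivalence relation. -/
instance QuiverRep.isoSetoid (K : Type u) [Field K] (Q : FinQuiver.{u}) :
    Setoid (QuiverRep K Q) where
  r := QuiverRep.IsIsomorphic
  iseqv :=
    { refl := fun A => ⟨QuiverRep.Iso.refl A⟩
      symm := fun ⟨e⟩ => ⟨e.symm⟩
      trans := fun ⟨e⟩ ⟨f⟩ => ⟨e.trans f⟩ }

/-- Isomorphism classes of representations of `Q` over `K`. -/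
def RepClass (K : Type u) [Field K] (Q : FinQuiver.{u}) : Type (u + 1) :=
  Quotient (QuiverRep.isoSetoid K Q)

namespace RepClass

variable {K : Type u} [Field K] {Q : FinQuiver.{u}}

/-- The isomorphism class of a representation. -/
def mk (A : QuiverRep K Q) : RepClass K Q := Quotient.mk _ A

theorem mk_eq_mk_iff {A B : QuiverRep K Q} : mk A = mk B ↔ A.IsIsomorphic B :=
  Quotient.eq

/-- Isomorphism classes of representations form a commutative monoid under tensor product. -/
instance : CommMonoid (RepClass K Q) where
  mul := Quotient.map₂ QuiverRep.tensor (by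
    rintro A A' ⟨e⟩ B B' ⟨f⟩
    refine ⟨⟨fun x => TensorProduct.congr (e.equiv x) (f.equiv x), fun a m => ?_⟩⟩
    exact LinearMap.congr_fun (f := (TensorProduct.congr (e.equiv _) (f.equiv _)).toLinearMap ∘ₗ
        TensorProduct.map (A.map a) (B.map a))
      (g := TensorProduct.map (A'.map a) (B'.map a) ∘ₗ
        (TensorProduct.congr (e.equiv _) (f.equiv _)).toLinearMap)
      (TensorProduct.ext' fun _ _ => by simp [e.comm, f.comm]) m)
  one := mk (QuiverRep.identityRep K Q)
  mul_assoc := by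
    rintro ⟨A⟩ ⟨B⟩ ⟨D⟩
    refine Quotient.sound ⟨⟨fun x => TensorProduct.assoc K _ _ _, fun a m => ?_⟩⟩
    exact LinearMap.congr_fun (f := (TensorProduct.assoc K _ _ _).toLinearMap ∘ₗ
        TensorProduct.map (TensorProduct.map (A.map a) (B.map a)) (D.map a))
      (g := TensorProduct.map (A.map a) (TensorProduct.map (B.map a) (D.map a)) ∘ₗ
        (TensorProduct.assoc K _ _ _).toLinearMap)
      (TensorProduct.ext_threefold fun _ _ _ => by simp) m
  one_mul := by
    rintro ⟨A⟩
    refine Quotient.sound ⟨⟨fun x => TensorProduct.lid K _, fun a m => ?_⟩⟩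
    exact LinearMap.congr_fun (f := (TensorProduct.lid K _).toLinearMap ∘ₗ
        TensorProduct.map LinearMap.id (A.map a))
      (g := A.map a ∘ₗ (TensorProduct.lid K _).toLinearMap)
      (TensorProduct.ext' fun _ _ => by simp) m
  mul_one := by
    rintro ⟨A⟩
    refine Quotient.sound ⟨⟨fun x => TensorProduct.rid K _, fun a m => ?_⟩⟩
    exact LinearMap.congr_fun (f := (TensorProduct.rid K _).toLinearMap ∘ₗ
        TensorProduct.map (A.map a) LinearMap.id)
      (g := A.map a ∘ₗ (TensorProduct.rid K _).toLinearMap)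
      (TensorProduct.ext' fun _ _ => by simp) m
  mul_comm := by
    rintro ⟨A⟩ ⟨B⟩
    refine Quotient.sound ⟨⟨fun x => TensorProduct.comm K _ _, fun a m => ?_⟩⟩
    exact LinearMap.congr_fun (f := (TensorProduct.comm K _ _).toLinearMap ∘ₗ
        TensorProduct.map (A.map a) (B.map a))
      (g := TensorProduct.map (B.map a) (A.map a) ∘ₗ (TensorProduct.comm K _ _).toLinearMap)
      (TensorProduct.ext' fun _ _ => by simp) m

theorem mk_mul_mk (A B : QuiverRep K Q) : mk A * mk B = mk (A.tensor B) := rfl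

theorem one_eq : (1 : RepClass K Q) = mk (QuiverRep.identityRep K Q) := rfl

variable (K Q) in
/-- The elements `[A ⊕ B] - [A] - [B]` of the free abelian group on isomorphism classes. -/
def relations : Set (FreeAbelianGroup (RepClass K Q)) :=
  {r | ∃ A B : QuiverRep K Q, r = FreeAbelianGroup.of (mk (A.directSum B)) -
    FreeAbelianGroup.of (mk A) - FreeAbelianGroup.of (mk B)}

end RepClass

/-- The representation ring `R(Q)`: the free abelian group on isomorphism classes of
representations, with product induced by the tensor product, modulo the relations
`[A ⊕ B] - [A] - [B]`. The ideal and the subgroup generated by the relations are equal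
(`RepClass.span_relations`). -/
abbrev RepRing (K : Type u) [Field K] (Q : FinQuiver.{u}) : Type (u + 1) :=
  FreeAbelianGroup (RepClass K Q) ⧸ Ideal.span (RepClass.relations K Q)

/-- The class of a representation in the representation ring. -/
def QuiverRep.toRepRing {K : Type u} [Field K] {Q : FinQuiver.{u}} (A : QuiverRep K Q) :
    RepRing K Q :=
  Ideal.Quotient.mk _ (FreeAbelianGroup.of (RepClass.mk A))

theorem RepClass.mul_mk_directSum {K : Type u} [Field K] {Q : FinQuiver.{u}}
    (A B D : QuiverRep K Q) :
    mk A * mk (B.directSum D) = mk ((A.tensor B).directSum (A.tensor D)) := by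
  refine Quotient.sound ⟨⟨fun x => TensorProduct.prodRight K K _ _ _, fun a m => ?_⟩⟩
  exact LinearMap.congr_fun (f := (TensorProduct.prodRight K K _ _ _).toLinearMap ∘ₗ
      TensorProduct.map (A.map a) ((B.map a).prodMap (D.map a)))
    (g := (TensorProduct.map (A.map a) (B.map a)).prodMap (TensorProduct.map (A.map a) (D.map a)) ∘ₗ
      (TensorProduct.prodRight K K _ _ _).toLinearMap)
    (TensorProduct.ext' fun _ _ => by simp) m

theorem RepClass.span_relations (K : Type u) [Field K] (Q : FinQuiver.{u}) :
    (Ideal.span (relations K Q)).toAddSubgroup = AddSubgroup.closure (relations K Q) := by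
  apply le_antisymm
  · intro r hr
    replace hr : r ∈ Ideal.span (relations K Q) := hr
    induction hr using Submodule.span_induction with
    | mem r h => exact AddSubgroup.subset_closure h
    | zero => exact zero_mem _
    | add r r' _ _ h h' => exact add_mem h h'
    | smul c r hr h =>
      rw [smul_eq_mul]
      clear hr
      induction c using FreeAbelianGroup.induction_on with
      | zero => rw [zero_mul]; exact zero_mem _
      | of c =>
        induction h using AddSubgroup.closure_induction with
        | mem r h =>
          obtain ⟨B, D, rfl⟩ := h
          obtain ⟨A, rfl⟩ : ∃ A, mk A = c := Quotient.exists_rep c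
          refine AddSubgroup.subset_closure ⟨A.tensor B, A.tensor D, ?_⟩
          rw [mul_sub, mul_sub, FreeAbelianGroup.of_mul_of, FreeAbelianGroup.of_mul_of,
            FreeAbelianGroup.of_mul_of]
          rw [mul_mk_directSum, mk_mul_mk, mk_mul_mk]
        | zero => rw [mul_zero]; exact zero_mem _
        | add r r' _ _ h h' => rw [mul_add]; exact add_mem h h'
        | neg r _ h => rw [mul_neg]; exact neg_mem h
      | neg c h => rw [neg_mul]; exact neg_mem h
      | add c c' h h' => rw [add_mul]; exact add_mem h h'
  · rw [AddSubgroup.closure_le]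
    exact Ideal.subset_span

/-! ### Acyclic categories and the Möbius ring -/

/-- A category is acyclic if its only endomorphisms are identities and only identities are
invertible. -/
class IsAcyclicCategory (C : Type v) [Category.{w} C] : Prop where
  endo_eq_id : ∀ (x : C) (f : x ⟶ x), f = 𝟙 x
  isIso_eq_id : ∀ (x y : C) (f : x ⟶ y), IsIso f → ∃ h : x = y, f = eqToHom h

/-- Each object `x` receives morphisms from finitely many objects only. -/
class IsLowerFinite (C : Type v) [Category.{w} C] : Prop where
  finite_below : ∀ x : C, {z : C | Nonempty (z ⟶ x)}.Finite

/-- Finitely many objects suffice. -/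
instance (C : Type v) [Category.{w} C] [Finite C] : IsLowerFinite C where
  finite_below _ := Set.toFinite _

section Moebius

variable {C : Type v} [Category.{w} C]

theorem IsAcyclicCategory.antisymm [IsAcyclicCategory C] {x y : C} (f : x ⟶ y) (g : y ⟶ x) :
    x = y :=
  (isIso_eq_id x y f ⟨g, endo_eq_id _ _, endo_eq_id _ _⟩).1

/-- The number `[x, y]` of morphisms from `x` to `y`. -/
noncomputable def homCount (x y : C) : ℕ := Nat.card (x ⟶ y)

theorem homCount_self [IsAcyclicCategory C] (x : C) : homCount x x = 1 := by
  have : Unique (x ⟶ x) := ⟨⟨𝟙 x⟩, IsAcyclicCategory.endo_eq_id x⟩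
  exact Nat.card_unique

theorem nonempty_of_homCount_ne_zero {x y : C} (h : homCount x y ≠ 0) : Nonempty (x ⟶ y) := by
  by_contra h'
  rw [not_nonempty_iff] at h'
  exact h Nat.card_of_isEmpty

variable [IsLowerFinite C]

/-- The objects mapping to `x`. -/
noncomputable def below (x : C) : Finset C := (IsLowerFinite.finite_below x).toFinset

theorem mem_below {z x : C} : z ∈ below x ↔ Nonempty (z ⟶ x) := by simp [below]

open Classical in
/-- The objects `z` with `x < z ≤ y`, where `x ≤ y` means that there is a morphism from `x`
to `y`. -/
noncomputable def between (x y : C) : Finset C :=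
  (below y).filter fun z => Nonempty (x ⟶ z) ∧ z ≠ x

theorem mem_between {x y z : C} :
    z ∈ between x y ↔ Nonempty (z ⟶ y) ∧ Nonempty (x ⟶ z) ∧ z ≠ x := by
  simp [between, mem_below]

theorem card_between_lt [IsAcyclicCategory C] {x y z : C} (h : z ∈ between x y) :
    (between z y).card < (between x y).card := by
  apply Finset.card_lt_card
  obtain ⟨⟨p⟩, ⟨q⟩, hne⟩ := mem_between.1 h
  rw [Finset.ssubset_iff_of_subset]
  · exact ⟨z, h, fun h' => (mem_between.1 h').2.2 rfl⟩
  · intro a ha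
    obtain ⟨ha₁, ⟨r⟩, ha₃⟩ := mem_between.1 ha
    refine mem_between.2 ⟨ha₁, ⟨q ≫ r⟩, ?_⟩
    rintro rfl
    exact hne (IsAcyclicCategory.antisymm r q)

open Classical in
/-- The Möbius function: `μ(x, x) = 1` and
`μ(x, y) = - ∑_{x < z ≤ y} [x, z] μ(z, y)` for `x ≠ y`. -/
noncomputable def moebius [IsAcyclicCategory C] (x y : C) : ℤ :=
  if x = y then 1 else - ∑ z : between x y, (homCount x z.1 : ℤ) * moebius z.1 y
termination_by (between x y).card
decreasing_by exact card_between_lt z.2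

variable [IsAcyclicCategory C]

theorem moebius_self (x : C) : moebius x x = 1 := by
  rw [moebius, if_pos rfl]

theorem moebius_of_ne {x y : C} (h : x ≠ y) :
    moebius x y = - ∑ z ∈ between x y, (homCount x z : ℤ) * moebius z y := by
  rw [moebius, if_neg h,
    Finset.sum_coe_sort (between x y) fun z => (homCount x z : ℤ) * moebius z y]

open Classical in
/-- The defining property of the Möbius function (the terms with `z` not below `y` vanish). -/
theorem sum_homCount_mul_moebius (x y : C) :
    ∑ z ∈ below y, (homCount x z : ℤ) * moebius z y = if x = y then 1 else 0 := by
  have hfil : (below y).filter (fun z => Nonempty (x ⟶ z)) ⊆ below y := Finset.filter_subset _ _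
  rw [← Finset.sum_subset hfil]
  swap
  · intro z hz hz'
    have h0 : homCount x z = 0 := by
      by_contra h
      exact hz' (Finset.mem_filter.2 ⟨hz, nonempty_of_homCount_ne_zero h⟩)
    simp [h0]
  by_cases hxy : Nonempty (x ⟶ y)
  · have hset : (below y).filter (fun z => Nonempty (x ⟶ z)) = insert x (between x y) := by
      ext z
      simp only [Finset.mem_filter, mem_below, Finset.mem_insert, mem_between]
      constructor
      · rintro ⟨h₁, h₂⟩
        by_cases h : z = x
        · exact Or.inl h
        · exact Or.inr ⟨h₁, h₂, h⟩
      · rintro (rfl | ⟨h₁, h₂, _⟩)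
        · exact ⟨hxy, ⟨𝟙 _⟩⟩
        · exact ⟨h₁, h₂⟩
    rw [hset, Finset.sum_insert fun h => (mem_between.1 h).2.2 rfl, homCount_self]
    split_ifs with h
    · subst h
      have : between x x = ∅ := by
        ext z
        simp only [mem_between, Finset.notMem_empty, iff_false]
        rintro ⟨⟨p⟩, ⟨q⟩, hne⟩
        exact hne (IsAcyclicCategory.antisymm p q)
      simp [this, moebius_self]
    · rw [moebius_of_ne h]
      simp
  · have hset : (below y).filter (fun z => Nonempty (x ⟶ z)) = ∅ := by
      ext z
      simp only [Finset.mem_filter, mem_below, Finset.notMem_empty, iff_false]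
      rintro ⟨⟨p⟩, ⟨q⟩⟩
      exact hxy ⟨q ≫ p⟩
    rw [hset, Finset.sum_empty, if_neg]
    rintro rfl
    exact hxy ⟨𝟙 _⟩

end Moebius

/-- The additive group of the Möbius ring: the free abelian group on the objects of `C`. -/
def MobiusRing (C : Type v) : Type v := C →₀ ℤ

namespace MobiusRing

variable {C : Type v}

noncomputable instance : AddCommGroup (MobiusRing C) := inferInstanceAs (AddCommGroup (C →₀ ℤ))

/-- The basis element given by an object. -/
noncomputable def of (x : C) : MobiusRing C := Finsupp.single x (1 : ℤ)

/-- The additive map out of the Möbius ring with prescribed values on the objects. -/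
noncomputable def lift {A : Type*} [AddCommGroup A] (f : C → A) : MobiusRing C →+ A :=
  Finsupp.liftAddHom fun x => (smulAddHom ℤ A).flip (f x)

theorem lift_of {A : Type*} [AddCommGroup A] (f : C → A) (x : C) : lift f (of x) = f x :=
  (Finsupp.liftAddHom_apply_single _ _ _).trans (by simp)

theorem hom_ext {A : Type*} [AddCommGroup A] {f g : MobiusRing C →+ A}
    (h : ∀ x, f (of x) = g (of x)) : f = g :=
  Finsupp.addHom_ext' (N := A) fun x => AddMonoidHom.ext_int (h x)

variable [Category.{w} C] [IsLowerFinite C]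

/-- The additive map sending `x` to `∑_z [z, x] e_z`, where `e_z` are the standard idempotents of
the ring of finitely supported functions `C → ℤ` (with pointwise product). -/
noncomputable def zeta : MobiusRing C →+ (C →₀ ℤ) :=
  lift fun x => ∑ z ∈ below x, Finsupp.single z (homCount z x : ℤ)

theorem zeta_of_apply (x z : C) : zeta (of x) z = homCount z x := by
  classical
  rw [zeta, lift_of, Finsupp.finsetSum_apply]
  simp only [Finsupp.single_apply, Finset.sum_ite_eq']
  split_ifs with h
  · rfl
  · by_contra h'
    refine h (mem_below.2 (nonempty_of_homCount_ne_zero (C := C) fun h0 => h' ?_))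
    simp [h0]

variable [IsAcyclicCategory C]

/-- The element `δ_x = ∑_z μ(z, x) z`. -/
noncomputable def delta (x : C) : MobiusRing C := ∑ z ∈ below x, moebius z x • of z

theorem zeta_delta (x : C) : zeta (delta x) = Finsupp.single x 1 := by
  classical
  ext w
  rw [delta, map_sum, Finsupp.finsetSum_apply, Finsupp.single_apply]
  simp_rw [map_zsmul, Finsupp.smul_apply, zeta_of_apply, smul_eq_mul, mul_comm (moebius _ x)]
  rw [sum_homCount_mul_moebius]
  simp only [eq_comm]

/-- The additive map sending `e_x` to `δ_x`. -/
noncomputable def ofDelta : (C →₀ ℤ) →+ MobiusRing C :=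
  Finsupp.liftAddHom fun x => (smulAddHom ℤ (MobiusRing C)).flip (delta x)

theorem ofDelta_single (x : C) : ofDelta (Finsupp.single x 1) = delta x := by
  simp [ofDelta]

theorem zeta_ofDelta (a : C →₀ ℤ) : zeta (ofDelta a) = a := by
  have : zeta.comp (ofDelta (C := C)) = AddMonoidHom.id _ :=
    Finsupp.addHom_ext' fun x => AddMonoidHom.ext_int (by
      simp [ofDelta_single, zeta_delta])
  exact DFunLike.congr_fun this a

theorem of_mem_range_ofDelta (x : C) : of x ∈ (ofDelta (C := C)).range := by
  classical
  induction hn : (below x).card using Nat.strong_induction_on generalizing x with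
  | _ n ih =>
    have hx : x ∈ below x := mem_below.2 ⟨𝟙 x⟩
    have h : of x = delta x - ∑ z ∈ (below x).erase x, moebius z x • of z := by
      rw [delta, ← Finset.add_sum_erase _ _ hx, moebius_self, one_smul, add_sub_cancel_right]
    rw [h]
    refine sub_mem ⟨_, ofDelta_single x⟩ (sum_mem fun z hz => zsmul_mem (ih _ ?_ z rfl) _)
    obtain ⟨hzx, hz⟩ := Finset.mem_erase.1 hz
    obtain ⟨p⟩ := mem_below.1 hz
    rw [← hn]
    apply Finset.card_lt_card
    rw [Finset.ssubset_iff_of_subset]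
    · refine ⟨x, hx, fun h => ?_⟩
      obtain ⟨q⟩ := mem_below.1 h
      exact hzx (IsAcyclicCategory.antisymm p q)
    · intro y hy
      obtain ⟨q⟩ := mem_below.1 hy
      exact mem_below.2 ⟨q ≫ p⟩

theorem ofDelta_zeta (a : MobiusRing C) : ofDelta (zeta a) = a := by
  have : (ofDelta (C := C)).comp zeta = AddMonoidHom.id _ := hom_ext fun x => by
    obtain ⟨b, hb⟩ := of_mem_range_ofDelta x
    simp [← hb, zeta_ofDelta]
  exact DFunLike.congr_fun this a

/-- The product of the Möbius ring: the `δ_x`, which form a `ℤ`-basis, are declared to be orthogonal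
idempotents (`MobiusRing.delta_mul_delta`), and this is extended bilinearly. -/
noncomputable instance : Mul (MobiusRing C) := ⟨fun a b => ofDelta (zeta a * zeta b)⟩

theorem mul_def (a b : MobiusRing C) : a * b = ofDelta (zeta a * zeta b) := rfl

theorem zeta_mul (a b : MobiusRing C) : zeta (a * b) = zeta a * zeta b := by
  rw [mul_def, zeta_ofDelta]

theorem zeta_injective : Function.Injective (zeta (C := C)) :=
  Function.LeftInverse.injective ofDelta_zeta

/-- The Möbius ring, a commutative ring that need not have an identity element. -/
noncomputable instance : NonUnitalCommRing (MobiusRing C) where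
  __ := (inferInstance : AddCommGroup (MobiusRing C))
  mul := (· * ·)
  left_distrib a b c := zeta_injective (by simp only [zeta_mul, map_add, mul_add])
  right_distrib a b c := zeta_injective (by simp only [zeta_mul, map_add, add_mul])
  zero_mul a := zeta_injective (by simp only [zeta_mul, map_zero, zero_mul])
  mul_zero a := zeta_injective (by simp only [zeta_mul, map_zero, mul_zero])
  mul_assoc a b c := zeta_injective (by simp only [zeta_mul, mul_assoc])
  mul_comm a b := zeta_injective (by simp only [zeta_mul, mul_comm])

open Classical in
theorem delta_mul_delta (x y : C) : delta x * delta y = if x = y then delta x else 0 := by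
  apply zeta_injective
  ext z
  rw [zeta_mul, zeta_delta, zeta_delta, Finsupp.mul_apply]
  split_ifs with h
  · subst h
    rw [zeta_delta, Finsupp.single_apply]
    split_ifs <;> simp
  · rw [map_zero, Finsupp.single_apply, Finsupp.single_apply]
    split_ifs with h₁ h₂
    · exact absurd (h₁.trans h₂.symm) h
    all_goals simp

/-- The basis elements are recovered from the idempotents. -/
theorem of_eq_sum_delta (x : C) : of x = ∑ z ∈ below x, homCount z x • delta z := by
  have h : ∀ z : C, ofDelta (Finsupp.single z (homCount z x : ℤ)) = homCount z x • delta z := by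
    intro z
    rw [← ofDelta_single, ← map_nsmul, Finsupp.smul_single, nsmul_eq_mul, mul_one]
  rw [← ofDelta_zeta (of x), zeta, lift_of, map_sum]
  exact Finset.sum_congr rfl fun z _ => h z

/-- The product of two basis elements. -/
theorem of_mul_of (x y : C) :
    of x * of y = ∑ w ∈ below x, (homCount w x * homCount w y) • delta w := by
  apply zeta_injective
  ext z
  classical
  rw [zeta_mul, Finsupp.mul_apply, zeta_of_apply, zeta_of_apply, map_sum, Finsupp.finsetSum_apply]
  simp_rw [map_nsmul, zeta_delta, Finsupp.smul_apply, Finsupp.single_apply, smul_ite, smul_zero,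
    Finset.sum_ite_eq', nsmul_eq_mul, mul_one]
  split_ifs with h
  · push_cast; rfl
  · have h0 : homCount z x = 0 := by
      by_contra h'
      exact h (mem_below.2 (nonempty_of_homCount_ne_zero h'))
    simp [h0]

end MobiusRing

/-- The additive extension `M(C) → R(Q)` of the linearization, for a full subcategory of the
category of quivers over `Q` with class of objects `C`. -/
noncomputable def linearizationMap (K : Type u) [Field K] {Q : FinQuiver.{u}}
    (C : ObjectProperty (QuiverOver Q)) : MobiusRing C.FullSubcategory →+ RepRing K Q :=
  MobiusRing.lift fun X => (X.obj.linearization K).toRepRing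

/-! ### Homomorphisms of representations -/

namespace QuiverRep

variable {K : Type u} [Field K] {Q : FinQuiver.{u}}

/-! The map is multiplicative because fiber products compute the product on both sides. The
injective map `MobiusRing.zeta` turns the product of the Möbius ring into the pointwise product and
sends `X` to the function `Z ↦ |Hom(Z, X)|`. If `X ×_Q Y` is the disjoint union of the `w i`, then
`|Hom(Z, X)| |Hom(Z, Y)| = |Hom(Z, X ×_Q Y)| = ∑ |Hom(Z, w i)|`, the last step because a connected
`Z` maps into a single summand (`QuiverOver.card_hom_fiberProduct`). So `X * Y = ∑ w i` in the
Möbius ring (`MobiusRing.of_mul_of_eq_sum`). In the representation ring, `L(X) ⊗ L(Y) ≅ L(X ×_Q Y)`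
(`QuiverOver.linearization_tensor`), and `L` takes disjoint unions to direct sums
(`QuiverOver.toRepRing_linearization_disjointUnion`).

Injectivity says that pairwise non-isomorphic indecomposables are linearly independent in the
representation ring. The full Krull–Schmidt theorem is not needed: for each indecomposable `A` it
suffices to have an additive functional that is positive on `A` and zero on every other
indecomposable. Such a functional is `dim Hom(A, V) - dim Rad(A, V)`, where `Rad(A, V)` consists of
the `f` for which no `g ∘ f` is invertible. That `Rad` is a subspace uses that `End(A)` is local,
which follows from Fitting's lemma.

Finally, the image of a ring homomorphism is a subring, and it is additively spanned by the classes
`[L(X)]`; hence it is the subring that they generate. -/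

/-- The space of homomorphisms of representations. -/
def homs (A B : QuiverRep K Q) : Submodule K (∀ x, A.obj x →ₗ[K] B.obj x) where
  carrier := {f | ∀ a, f (Q.t a) ∘ₗ A.map a = B.map a ∘ₗ f (Q.s a)}
  zero_mem' a := by simp
  add_mem' hf hg a := by
    simp only [Pi.add_apply, LinearMap.add_comp, LinearMap.comp_add, hf a, hg a]
  smul_mem' c f hf a := by
    simp only [Pi.smul_apply, LinearMap.smul_comp, LinearMap.comp_smul, hf a]

theorem homs_apply {A B : QuiverRep K Q} {f : ∀ x, A.obj x →ₗ[K] B.obj x} (hf : f ∈ homs A B)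
    (a : Q.E) (m : A.obj (Q.s a)) : f (Q.t a) (A.map a m) = B.map a (f (Q.s a) m) :=
  LinearMap.congr_fun (hf a) m

theorem comp_mem_homs {A B D : QuiverRep K Q} {f : ∀ x, A.obj x →ₗ[K] B.obj x}
    {g : ∀ x, B.obj x →ₗ[K] D.obj x} (hg : g ∈ homs B D) (hf : f ∈ homs A B) :
    (fun x => g x ∘ₗ f x) ∈ homs A D := fun a => by
  ext m
  simp [homs_apply hf, homs_apply hg]

/-- Homomorphisms that are bijective at each vertex give an isomorphism. -/
noncomputable def isoOfBijective {A B : QuiverRep K Q} {f : ∀ x, A.obj x →ₗ[K] B.obj x}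
    (hf : f ∈ homs A B) (h : ∀ x, Function.Bijective (f x)) : Iso A B where
  equiv x := LinearEquiv.ofBijective (f x) (h x)
  comm a m := homs_apply hf a m

theorem Iso.mem_homs {A B : QuiverRep K Q} (e : Iso A B) :
    (fun x => (e.equiv x : A.obj x →ₗ[K] B.obj x)) ∈ homs A B := fun a => by
  ext m
  exact e.comm a m

variable (K) in
/-- The ring of families of endomorphisms of the spaces of a representation. -/
abbrev EndFamily (A : QuiverRep K Q) : Type u := ∀ x, Module.End K (A.obj x)

theorem isUnit_endFamily_iff {A : QuiverRep K Q} {f : EndFamily K A} :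
    IsUnit f ↔ ∀ x, Function.Bijective (f x) := by
  simp_rw [Pi.isUnit_iff, Module.End.isUnit_iff]

theorem one_mem_homs (A : QuiverRep K Q) : (1 : EndFamily K A) ∈ homs A A := fun a => by
  ext m; rfl

theorem mul_mem_homs {A : QuiverRep K Q} {f g : EndFamily K A} (hf : f ∈ homs A A)
    (hg : g ∈ homs A A) : f * g ∈ homs A A := comp_mem_homs hf hg

theorem pow_mem_homs {A : QuiverRep K Q} {f : EndFamily K A} (hf : f ∈ homs A A) (n : ℕ) :
    f ^ n ∈ homs A A := by
  induction n with
  | zero => rw [pow_zero]; exact one_mem_homs A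
  | succ n ih => rw [pow_succ]; exact mul_mem_homs ih hf

/-- This allows invertibility of an endomorphism to be tested in the product ring `EndFamily K A`,
where it is bijectivity at each vertex. -/
theorem inv_mem_homs {A : QuiverRep K Q} {f g : EndFamily K A} (hf : f ∈ homs A A)
    (hgf : g * f = 1) (hfg : f * g = 1) : g ∈ homs A A := fun a => by
  ext m
  have h₁ : ∀ x (m : A.obj x), g x (f x m) = m := fun x m =>
    LinearMap.congr_fun (congr_fun hgf x) m
  have h₂ : ∀ x (m : A.obj x), f x (g x m) = m := fun x m =>
    LinearMap.congr_fun (congr_fun hfg x) m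
  have := homs_apply hf a (g _ m)
  rw [h₂] at this
  exact (congrArg (g (Q.t a)) this).symm.trans (h₁ _ _)

/-! ### Decompositions and Fitting's lemma -/

/-- The subrepresentation given by a compatible family of subspaces. -/
def sub (A : QuiverRep K Q) (p : ∀ x, Submodule K (A.obj x))
    (hp : ∀ a, ∀ m ∈ p (Q.s a), A.map a m ∈ p (Q.t a)) : QuiverRep K Q where
  obj x := p x
  map a := (A.map a).restrict (hp a)

/-- Complementary subrepresentations give a decomposition into a direct sum. -/
theorem isIsomorphic_directSum_sub (A : QuiverRep K Q) {p q : ∀ x, Submodule K (A.obj x)}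
    (hp : ∀ a, ∀ m ∈ p (Q.s a), A.map a m ∈ p (Q.t a))
    (hq : ∀ a, ∀ m ∈ q (Q.s a), A.map a m ∈ q (Q.t a)) (h : ∀ x, IsCompl (p x) (q x)) :
    A.IsIsomorphic ((A.sub p hp).directSum (A.sub q hq)) := by
  refine ⟨Iso.symm ⟨fun x => Submodule.prodEquivOfIsCompl (p x) (q x) (h x), ?_⟩⟩
  rintro a ⟨m, n⟩
  refine Eq.trans (Submodule.coe_prodEquivOfIsCompl' _ _ _ _) (Eq.trans ?_ (congrArg (A.map a)
    (Submodule.coe_prodEquivOfIsCompl' _ _ (h (Q.s a)) (m, n)).symm))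
  rw [map_add]
  rfl

theorem IsIndecomposable.eq_bot_or_eq_bot {A : QuiverRep K Q} (hA : A.IsIndecomposable)
    {p q : ∀ x, Submodule K (A.obj x)}
    (hp : ∀ a, ∀ m ∈ p (Q.s a), A.map a m ∈ p (Q.t a))
    (hq : ∀ a, ∀ m ∈ q (Q.s a), A.map a m ∈ q (Q.t a)) (h : ∀ x, IsCompl (p x) (q x)) :
    (∀ x, p x = ⊥) ∨ (∀ x, q x = ⊥) := by
  refine (hA.2 _ _ (A.isIsomorphic_directSum_sub hp hq h)).imp (fun h x => ?_) (fun h x => ?_)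
  · have : Subsingleton (p x) := h x
    exact Submodule.subsingleton_iff_eq_bot.1 this
  · have : Subsingleton (q x) := h x
    exact Submodule.subsingleton_iff_eq_bot.1 this

theorem ker_invariant {A B : QuiverRep K Q} {f : ∀ x, A.obj x →ₗ[K] B.obj x}
    (hf : f ∈ homs A B) (a : Q.E) (m : A.obj (Q.s a)) (hm : m ∈ LinearMap.ker (f (Q.s a))) :
    A.map a m ∈ LinearMap.ker (f (Q.t a)) := by
  rw [LinearMap.mem_ker] at hm ⊢
  rw [homs_apply hf, hm, map_zero]

theorem range_invariant {A B : QuiverRep K Q} {f : ∀ x, A.obj x →ₗ[K] B.obj x}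
    (hf : f ∈ homs A B) (a : Q.E) (m : B.obj (Q.s a)) (hm : m ∈ LinearMap.range (f (Q.s a))) :
    B.map a m ∈ LinearMap.range (f (Q.t a)) := by
  obtain ⟨m, rfl⟩ := hm
  exact ⟨A.map a m, homs_apply hf a m⟩

/-- Fitting's lemma: an endomorphism of an indecomposable representation is nilpotent or
invertible. -/
theorem IsIndecomposable.isNilpotent_or_isUnit {A : QuiverRep K Q} (hA : A.IsIndecomposable)
    {f : EndFamily K A} (hf : f ∈ homs A A) : IsNilpotent f ∨ IsUnit f := by
  -- As `Q` has finitely many vertices, one exponent gives the decomposition kernel ⊕ range at all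
  -- of them. It is raised to `n + 1` so that it is nonzero, as `isUnit_pow_iff` requires.
  obtain ⟨n, hn⟩ := (Filter.eventually_all.2 fun x =>
    (f x).eventually_isCompl_ker_pow_range_pow).exists_forall_of_atTop
  replace hn : ∀ x, IsCompl (LinearMap.ker ((f ^ (n + 1)) x)) (LinearMap.range ((f ^ (n + 1)) x)) :=
    hn (n + 1) n.le_succ
  have hfn := pow_mem_homs hf (n + 1)
  rcases hA.eq_bot_or_eq_bot (ker_invariant hfn) (range_invariant hfn) hn with h | h
  · right
    refine (isUnit_pow_iff n.succ_ne_zero).1 (isUnit_endFamily_iff.2 fun x => ?_)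
    refine ⟨LinearMap.ker_eq_bot.1 (h x), LinearMap.range_eq_top.1 ?_⟩
    have := (hn x).sup_eq_top
    rwa [h x, bot_sup_eq] at this
  · exact Or.inl ⟨n + 1, funext fun x => LinearMap.range_eq_bot.1 (h x)⟩

theorem IsIndecomposable.not_isUnit_zero {A : QuiverRep K Q} (hA : A.IsIndecomposable) :
    ¬ IsUnit (0 : EndFamily K A) := fun h => hA.1 fun x =>
  ⟨fun m n => (isUnit_endFamily_iff.1 h x).1 (by simp)⟩

/-- The endomorphism ring of an indecomposable representation is local. -/
theorem IsIndecomposable.isUnit_or_isUnit_of_add {A : QuiverRep K Q} (hA : A.IsIndecomposable)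
    {f g : EndFamily K A} (hf : f ∈ homs A A) (hg : g ∈ homs A A) (h : IsUnit (f + g)) :
    IsUnit f ∨ IsUnit g := by
  obtain ⟨u, hu⟩ := h
  -- Multiplying by `u⁻¹` normalizes the sum to `1`. By Fitting, `u⁻¹ * f` is invertible or
  -- nilpotent, and in the latter case `u⁻¹ * g = 1 - u⁻¹ * f` is invertible.
  have hui : (↑u⁻¹ : EndFamily K A) ∈ homs A A :=
    inv_mem_homs (f := (u : EndFamily K A)) (hu ▸ add_mem hf hg) (by simp) (by simp)
  rcases hA.isNilpotent_or_isUnit (mul_mem_homs hui hf) with h | h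
  · right
    have h' := h.isUnit_one_sub
    have : 1 - ↑u⁻¹ * f = ↑u⁻¹ * g := by
      rw [← Units.inv_mul u, hu, mul_add, add_sub_cancel_left]
    rw [this] at h'
    simpa using h'
  · left
    simpa using h

/-! ### Multiplicities of indecomposable representations -/

/-- The homomorphisms from an indecomposable representation `A` that have no component which is an
isomorphism onto a direct summand. -/
def radicalHoms {A : QuiverRep K Q} (hA : A.IsIndecomposable) (V : QuiverRep K Q) :
    Submodule K (∀ x, A.obj x →ₗ[K] V.obj x) where
  carrier := {f | f ∈ homs A V ∧ ∀ g ∈ homs V A, ¬ IsUnit (fun x => g x ∘ₗ f x : EndFamily K A)}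
  zero_mem' := ⟨zero_mem _, fun g _ => by
    have : (fun x => g x ∘ₗ (0 : ∀ x, A.obj x →ₗ[K] V.obj x) x : EndFamily K A) = 0 := by
      ext; simp
    rw [this]
    exact hA.not_isUnit_zero⟩
  add_mem' := by
    rintro f f' ⟨hf, h⟩ ⟨hf', h'⟩
    refine ⟨add_mem hf hf', fun g hg hu => ?_⟩
    have : (fun x => g x ∘ₗ (f + f') x : EndFamily K A) =
        (fun x => g x ∘ₗ f x : EndFamily K A) + (fun x => g x ∘ₗ f' x : EndFamily K A) := by
      ext; simp
    rw [this] at hu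
    exact (hA.isUnit_or_isUnit_of_add (comp_mem_homs hg hf) (comp_mem_homs hg hf') hu).elim
      (h g hg) (h' g hg)
  smul_mem' := by
    rintro c f ⟨hf, h⟩
    refine ⟨Submodule.smul_mem _ c hf, fun g hg hu => h (c • g) (Submodule.smul_mem _ c hg) ?_⟩
    have : (fun x => (c • g) x ∘ₗ f x : EndFamily K A) = fun x => g x ∘ₗ (c • f) x := by
      ext; simp
    rwa [this]

/-- A map `k` making `k ∘ (g ∘ f)` invertible would make `k ∘ g` a forbidden left factor for `f`. -/
theorem comp_mem_radicalHoms {A V W : QuiverRep K Q} {hA : A.IsIndecomposable}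
    {f : ∀ x, A.obj x →ₗ[K] V.obj x} {g : ∀ x, V.obj x →ₗ[K] W.obj x} (hg : g ∈ homs V W)
    (hf : f ∈ radicalHoms hA V) : (fun x => g x ∘ₗ f x) ∈ radicalHoms hA W :=
  ⟨comp_mem_homs hg hf.1, fun _ hk => hf.2 _ (comp_mem_homs hk hg)⟩

/-- The multiplicity of an indecomposable representation as a direct summand. -/
noncomputable def multiplicity {A : QuiverRep K Q} (hA : A.IsIndecomposable)
    (V : QuiverRep K Q) : ℤ :=
  Module.finrank K (homs A V) - Module.finrank K (radicalHoms hA V)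

/-- The identity of `A` is not radical, so the inclusion of subspaces is strict. The value is the
dimension of `End(A)` modulo its radical, which can exceed `1` when `K` is not algebraically closed;
positivity is all that linear independence needs. -/
theorem multiplicity_self_pos {A : QuiverRep K Q} (hA : A.IsIndecomposable) :
    0 < multiplicity hA A := by
  have hlt : radicalHoms hA A < homs A A := by
    refine lt_of_le_of_ne (fun f hf => hf.1) fun h => ?_
    have h1 : (1 : EndFamily K A) ∈ radicalHoms hA A := h ▸ one_mem_homs A
    exact h1.2 1 (one_mem_homs A) (isUnit_one (M := EndFamily K A))
  have := Submodule.finrank_lt_finrank_of_lt hlt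
  rw [multiplicity]
  omega

/-- If `g ∘ f` is bijective, `f` is a split embedding up to an automorphism: `n = f m + (n - f m)`,
where `m` solves `g (f m) = g n`. -/
theorem isCompl_range_ker_of_bijective_comp {M N : Type*} [AddCommGroup M] [Module K M]
    [AddCommGroup N] [Module K N] {f : M →ₗ[K] N} {g : N →ₗ[K] M}
    (h : Function.Bijective (g ∘ₗ f)) : IsCompl (LinearMap.range f) (LinearMap.ker g) := by
  constructor
  · rw [Submodule.disjoint_def]
    rintro _ ⟨m, rfl⟩ hm
    have : m = 0 := h.1 (by simpa using hm)
    rw [this, map_zero]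
  · rw [codisjoint_iff, eq_top_iff]
    intro n _
    obtain ⟨m, hm⟩ := h.2 (g n)
    refine Submodule.mem_sup.2 ⟨f m, ⟨m, rfl⟩, n - f m, ?_, add_sub_cancel _ _⟩
    rw [LinearMap.mem_ker, map_sub, ← hm, LinearMap.comp_apply, sub_self]

/-- Every homomorphism from `A` to `B` is radical. Otherwise some `g ∘ f` is invertible and `B` is
the direct sum of `range f` and `ker g`; since `B` is indecomposable and `A` is nonzero, `ker g =
0`, and then `f` is an isomorphism. -/
theorem multiplicity_eq_zero {A B : QuiverRep K Q} (hA : A.IsIndecomposable)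
    (hB : B.IsIndecomposable) (h : ¬ A.IsIsomorphic B) : multiplicity hA B = 0 := by
  have : radicalHoms hA B = homs A B := by
    refine le_antisymm (fun f hf => hf.1) fun f hf => ⟨hf, fun g hg hu => h ?_⟩
    rw [isUnit_endFamily_iff] at hu
    have hcompl : ∀ x, IsCompl (LinearMap.range (f x)) (LinearMap.ker (g x)) := fun x =>
      isCompl_range_ker_of_bijective_comp (hu x)
    have hinj : ∀ x, Function.Injective (f x) := fun x =>
      Function.Injective.of_comp (f := g x) (hu x).1
    rcases hB.eq_bot_or_eq_bot (range_invariant hf) (ker_invariant hg) hcompl with h' | h'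
    · refine absurd (fun x => ⟨fun m n => hinj x ?_⟩) hA.1
      rw [LinearMap.range_eq_bot.1 (h' x)]
      rfl
    · refine ⟨isoOfBijective hf fun x => ⟨hinj x, LinearMap.range_eq_top.1 ?_⟩⟩
      have := (hcompl x).sup_eq_top
      rwa [h' x, sup_bot_eq] at this
  rw [multiplicity, this, sub_self]

/-- Only stability under postcomposition matters, so the argument is given for any such family `S`
and serves both `homs A` and `radicalHoms hA`. -/
theorem finrank_congr_of_isIsomorphic {A V W : QuiverRep K Q}
    (S : ∀ V : QuiverRep K Q, Submodule K (∀ x, A.obj x →ₗ[K] V.obj x))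
    (hS : ∀ {V W : QuiverRep K Q} {f : ∀ x, A.obj x →ₗ[K] V.obj x}
      {g : ∀ x, V.obj x →ₗ[K] W.obj x}, g ∈ homs V W → f ∈ S V → (fun x => g x ∘ₗ f x) ∈ S W)
    (h : V.IsIsomorphic W) : Module.finrank K (S V) = Module.finrank K (S W) := by
  obtain ⟨e⟩ := h
  refine LinearEquiv.finrank_eq
    { toFun := fun f => ⟨_, hS e.mem_homs f.2⟩
      invFun := fun f => ⟨_, hS e.symm.mem_homs f.2⟩
      map_add' := fun f g => Subtype.ext (funext fun x => LinearMap.comp_add _ _ _)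
      map_smul' := fun c f => Subtype.ext (funext fun x => LinearMap.comp_smul _ _ _)
      left_inv := fun f => Subtype.ext (funext fun x => LinearMap.ext fun m =>
        (e.equiv x).symm_apply_apply _)
      right_inv := fun f => Subtype.ext (funext fun x => LinearMap.ext fun m =>
        (e.equiv x).apply_symm_apply _) }

theorem multiplicity_congr {A V W : QuiverRep K Q} (hA : A.IsIndecomposable)
    (h : V.IsIsomorphic W) : multiplicity hA V = multiplicity hA W := by
  rw [multiplicity, multiplicity, finrank_congr_of_isIsomorphic (homs A) comp_mem_homs h,
    finrank_congr_of_isIsomorphic (radicalHoms hA) comp_mem_radicalHoms h]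

theorem fst_mem_homs (V W : QuiverRep K Q) :
    (fun x => LinearMap.fst K (V.obj x) (W.obj x)) ∈ homs (V.directSum W) V := fun _ => rfl

theorem snd_mem_homs (V W : QuiverRep K Q) :
    (fun x => LinearMap.snd K (V.obj x) (W.obj x)) ∈ homs (V.directSum W) W := fun _ => rfl

theorem inl_mem_homs (V W : QuiverRep K Q) :
    (fun x => LinearMap.inl K (V.obj x) (W.obj x)) ∈ homs V (V.directSum W) := fun a => by
  exact LinearMap.ext fun m => Prod.ext rfl (map_zero (W.map a)).symm

theorem inr_mem_homs (V W : QuiverRep K Q) :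
    (fun x => LinearMap.inr K (V.obj x) (W.obj x)) ∈ homs W (V.directSum W) := fun a => by
  exact LinearMap.ext fun m => Prod.ext (map_zero (V.map a)).symm rfl

/-- A space of families of maps to a direct sum that is compatible with the inclusions and the
projections has the expected dimension. -/
theorem finrank_directSum_eq {A V W : QuiverRep K Q}
    (S : ∀ V : QuiverRep K Q, Submodule K (∀ x, A.obj x →ₗ[K] V.obj x))
    (hS : ∀ {V W : QuiverRep K Q} {f : ∀ x, A.obj x →ₗ[K] V.obj x}
      {g : ∀ x, V.obj x →ₗ[K] W.obj x}, g ∈ homs V W → f ∈ S V → (fun x => g x ∘ₗ f x) ∈ S W) :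
    Module.finrank K (S (V.directSum W)) = Module.finrank K (S V) + Module.finrank K (S W) := by
  rw [← Module.finrank_prod]
  refine LinearEquiv.finrank_eq
    { toFun := fun f => (⟨_, hS (fst_mem_homs V W) f.2⟩, ⟨_, hS (snd_mem_homs V W) f.2⟩)
      invFun := fun f => ⟨_, add_mem (hS (inl_mem_homs V W) f.1.2) (hS (inr_mem_homs V W) f.2.2)⟩
      map_add' := fun f g => rfl
      map_smul' := fun c f => rfl
      left_inv := fun f => ?_
      right_inv := fun f => ?_ }
  · refine Subtype.ext (funext fun x => LinearMap.ext fun m => Prod.ext ?_ ?_)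
    · exact add_zero _
    · exact zero_add _
  · refine Prod.ext (Subtype.ext (funext fun x => LinearMap.ext fun m => ?_))
      (Subtype.ext (funext fun x => LinearMap.ext fun m => ?_))
    · exact add_zero _
    · exact zero_add _

theorem multiplicity_directSum {A : QuiverRep K Q} (hA : A.IsIndecomposable)
    (V W : QuiverRep K Q) :
    multiplicity hA (V.directSum W) = multiplicity hA V + multiplicity hA W := by
  have h₁ := finrank_directSum_eq (A := A) (V := V) (W := W) (homs A) comp_mem_homs
  have h₂ := finrank_directSum_eq (A := A) (V := V) (W := W) (radicalHoms hA)
    comp_mem_radicalHoms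
  rw [multiplicity, multiplicity, multiplicity, h₁, h₂]
  push_cast
  ring

/-- The multiplicity as an additive map on the representation ring. -/
theorem exists_multiplicityHom {A : QuiverRep K Q} (hA : A.IsIndecomposable) :
    ∃ m : RepRing K Q →+ ℤ, ∀ V : QuiverRep K Q, m V.toRepRing = multiplicity hA V := by
  let F : FreeAbelianGroup (RepClass K Q) →+ ℤ := FreeAbelianGroup.lift
    (Quotient.lift (multiplicity hA) fun V W h => multiplicity_congr hA h)
  have hF : ∀ V, F (FreeAbelianGroup.of (RepClass.mk V)) = multiplicity hA V := fun V =>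
    FreeAbelianGroup.lift_apply_of _ _
  -- The functional `F` is additive but not multiplicative, so it can be checked on the relations
  -- only because they generate the ideal as an additive group.
  have hle : (Ideal.span (RepClass.relations K Q)).toAddSubgroup ≤ F.ker := by
    rw [RepClass.span_relations, AddSubgroup.closure_le]
    rintro _ ⟨V, W, rfl⟩
    rw [SetLike.mem_coe, AddMonoidHom.mem_ker, map_sub, map_sub, hF, hF, hF,
      multiplicity_directSum]
    ring
  exact ⟨QuotientAddGroup.lift (Ideal.span (RepClass.relations K Q)).toAddSubgroup F hle, hF⟩

/-! ### Classes in the representation ring -/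

theorem toRepRing_congr {V W : QuiverRep K Q} (h : V.IsIsomorphic W) :
    V.toRepRing = W.toRepRing := by
  rw [toRepRing, toRepRing, RepClass.mk_eq_mk_iff.2 h]

theorem toRepRing_directSum (V W : QuiverRep K Q) :
    (V.directSum W).toRepRing = V.toRepRing + W.toRepRing := by
  rw [← sub_eq_zero, ← sub_sub, toRepRing, toRepRing, toRepRing, ← map_sub, ← map_sub,
    Ideal.Quotient.eq_zero_iff_mem]
  exact Ideal.subset_span ⟨V, W, rfl⟩

theorem toRepRing_tensor (V W : QuiverRep K Q) :
    (V.tensor W).toRepRing = V.toRepRing * W.toRepRing := by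
  rw [toRepRing, toRepRing, toRepRing, ← map_mul, FreeAbelianGroup.of_mul_of, RepClass.mk_mul_mk]

/-- A zero representation satisfies `V ≅ V ⊕ V`, so `[V] = [V] + [V]`. -/
theorem IsZero.toRepRing_eq_zero {V : QuiverRep K Q} (h : V.IsZero) : V.toRepRing = 0 := by
  have : V.IsIsomorphic (V.directSum V) := by
    have h' : ∀ x, Subsingleton (V.obj x) := h
    refine ⟨isoOfBijective (inl_mem_homs V V) fun x => ⟨fun m n _ => Subsingleton.elim _ _, ?_⟩⟩
    exact fun p => ⟨p.1, Prod.ext (Subsingleton.elim _ _) (Subsingleton.elim _ _)⟩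
  simpa [toRepRing_directSum] using toRepRing_congr this

end QuiverRep

/-! ### Linearizations -/

namespace QuiverOver

variable {K : Type u} [Field K] {Q : FinQuiver.{u}}

/-- The vertices over a vertex of `Q`. -/
abbrev Fiber (X : QuiverOver Q) (x : Q.V) : Type u := {y : X.quiver.V // X.str.onV y = x}

/-- The arrows over an arrow of `Q` that end at a given vertex. -/
abbrev ArrowsTo (X : QuiverOver Q) (a : Q.E) (j : X.quiver.V) : Type u :=
  {b : X.quiver.E // X.str.onE b = a ∧ X.quiver.t b = j}

/-- The start of an arrow over `a`. -/
def ArrowsTo.start {X : QuiverOver Q} {a : Q.E} {j : X.quiver.V} (b : X.ArrowsTo a j) :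
    X.Fiber (Q.s a) :=
  ⟨X.quiver.s b.1, by rw [← X.str.s_onE, b.2.1]⟩

variable (K) in
/-- The space of the linearization at a vertex, as a space of functions. -/
noncomputable def linearizationEquiv (X : QuiverOver Q) (x : Q.V) :
    (X.linearization K).obj x ≃ₗ[K] (X.Fiber x → K) := LinearEquiv.refl K (X.Fiber x → K)

/-- Of the arrows over `a`, only those ending at `j` contribute to the coordinate `j`. From here on
a linearization is a space of functions on fibers, and its maps sum over incoming arrows. -/
theorem pushforwardMap_identityRep_apply (X : QuiverOver Q) (a : Q.E)
    (p : ∀ y : X.Fiber (Q.s a), (QuiverRep.identityRep K X.quiver).obj y.1)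
    (j : X.Fiber (Q.t a)) :
    (QuiverRep.pushforwardMap X.str (QuiverRep.identityRep K X.quiver) a p j : K) =
      ∑ᶠ b : X.ArrowsTo a j.1, (p b.start : K) := by
  classical
  have := Fintype.ofFinite {b : X.quiver.E // X.str.onE b = a}
  have := Fintype.ofFinite (X.ArrowsTo a j.1)
  rw [QuiverRep.pushforwardMap, finsum_eq_sum_of_fintype, LinearMap.sum_apply, Finset.sum_apply]
  refine Eq.trans (Eq.symm ?_) (finsum_eq_sum_of_fintype _).symm
  refine Fintype.sum_of_injective
    (fun b : X.ArrowsTo a j.1 => (⟨b.1, b.2.1⟩ : {b : X.quiver.E // X.str.onE b = a}))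
    (fun b c h => Subtype.ext (Subtype.mk.inj h)) _ _ (fun b hb => ?_) (fun b => ?_)
  · refine Pi.single_eq_of_ne (fun h => hb ⟨⟨b.1, b.2, ?_⟩, rfl⟩) _
    rw [h]
  -- Substituting the end of the arrow for `j` makes the two indices of the coordinate function
  -- agree definitionally.
  · obtain ⟨b, hb, hj⟩ := b
    obtain ⟨j, hj'⟩ := j
    dsimp only at hj
    subst hj
    exact (Pi.single_eq_same (M := fun _ : X.Fiber (Q.t a) => K) _ _).symm

theorem linearizationEquiv_map_apply (X : QuiverOver Q) (a : Q.E)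
    (p : (X.linearization K).obj (Q.s a)) (j : X.Fiber (Q.t a)) :
    linearizationEquiv K X _ ((X.linearization K).map a p) j =
      ∑ᶠ b : X.ArrowsTo a j.1, linearizationEquiv K X _ p b.start :=
  pushforwardMap_identityRep_apply X a p j

/-- Elements of a linearization are equal if they agree as functions. -/
theorem linearization_ext {X : QuiverOver Q} {x : Q.V} {p q : (X.linearization K).obj x}
    (h : ∀ j, linearizationEquiv K X x p j = linearizationEquiv K X x q j) : p = q :=
  (linearizationEquiv K X x).injective (funext h)

/-! ### Coverings and restriction of functions -/

/-- A morphism over `Q` is a right covering if each arrow ending in its image lifts uniquely, given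
a lift of its end. -/
def Hom.IsCovering {X Y : QuiverOver Q} (f : QuiverOver.Hom X Y) : Prop :=
  ∀ j, Set.BijOn f.map.onE {b | X.quiver.t b = j} {c | Y.quiver.t c = f.map.onV j}

/-- The map induced on fibers. -/
def Hom.onFiber {X Y : QuiverOver Q} (f : QuiverOver.Hom X Y) (x : Q.V) (y : X.Fiber x) :
    Y.Fiber x :=
  ⟨f.map.onV y.1, (f.str_onV _).trans y.2⟩

variable (K) in
/-- Restriction of functions along a morphism over `Q`. -/
noncomputable def Hom.restrict {X Y : QuiverOver Q} (f : QuiverOver.Hom X Y) (x : Q.V) :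
    (Y.linearization K).obj x →ₗ[K] (X.linearization K).obj x :=
  (linearizationEquiv K X x).symm.toLinearMap ∘ₗ LinearMap.funLeft K K (f.onFiber x) ∘ₗ
    (linearizationEquiv K Y x).toLinearMap

theorem Hom.restrict_apply {X Y : QuiverOver Q} (f : QuiverOver.Hom X Y) (x : Q.V)
    (p : (Y.linearization K).obj x) (j : X.Fiber x) :
    linearizationEquiv K X x (f.restrict K x p) j = linearizationEquiv K Y x p (f.onFiber x j) :=
  rfl

/-- Evaluated at `j`, both sides are sums over the arrows over `a` ending at `j` and at its image,
and a covering is a bijection between these. -/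
theorem Hom.IsCovering.restrict_mem_homs {X Y : QuiverOver Q} {f : QuiverOver.Hom X Y}
    (hf : f.IsCovering) :
    f.restrict K ∈ QuiverRep.homs (Y.linearization K) (X.linearization K) := fun a => by
  refine LinearMap.ext fun p => linearization_ext fun j => ?_
  rw [LinearMap.comp_apply, LinearMap.comp_apply, f.restrict_apply,
    linearizationEquiv_map_apply, linearizationEquiv_map_apply]
  symm
  refine finsum_eq_of_bijective
    (fun b : X.ArrowsTo a j.1 => (⟨f.map.onE b.1, (f.str_onE _).trans b.2.1,
      (hf j.1).mapsTo b.2.2⟩ : Y.ArrowsTo a (f.onFiber _ j).1)) ⟨fun b c h => ?_, fun c => ?_⟩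
    fun b => ?_
  · exact Subtype.ext ((hf j.1).injOn b.2.2 c.2.2 (congrArg Subtype.val h))
  · obtain ⟨b, hb, hbc⟩ := (hf j.1).surjOn c.2.2
    exact ⟨⟨b, by rw [← f.str_onE, hbc, c.2.1], hb⟩, Subtype.ext hbc⟩
  · rw [f.restrict_apply]
    exact congrArg _ (Subtype.ext (f.map.s_onE _).symm)

theorem Hom.isCovering_of_iso {X Y : QuiverOver Q} (e : X ≅ Y) :
    Hom.IsCovering (show QuiverOver.Hom X Y from e.hom) := by
  let f : QuiverOver.Hom X Y := e.hom
  let g : QuiverOver.Hom Y X := e.inv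
  have hgfV : ∀ i, g.map.onV (f.map.onV i) = i := fun i =>
    congrFun (congrArg (fun h : QuiverOver.Hom X X => h.map.onV) e.hom_inv_id) i
  have hgf : ∀ i, g.map.onE (f.map.onE i) = i := fun i =>
    congrFun (congrArg (fun h : QuiverOver.Hom X X => h.map.onE) e.hom_inv_id) i
  have hfg : ∀ i, f.map.onE (g.map.onE i) = i := fun i =>
    congrFun (congrArg (fun h : QuiverOver.Hom Y Y => h.map.onE) e.inv_hom_id) i
  intro j
  refine ⟨fun b hb => ?_, fun b _ c _ h => ?_, fun c hc => ⟨g.map.onE c, ?_, hfg c⟩⟩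
  · exact (f.map.t_onE b).trans (congrArg _ hb)
  · rw [← hgf b, ← hgf c]
    exact congrArg _ h
  · exact (g.map.t_onE c).trans ((congrArg _ hc).trans (hgfV j))

theorem linearization_isIsomorphic_of_iso {X Y : QuiverOver Q} (e : X ≅ Y) :
    (X.linearization K).IsIsomorphic (Y.linearization K) := by
  let f : QuiverOver.Hom X Y := e.hom
  let g : QuiverOver.Hom Y X := e.inv
  have hgf : ∀ i, g.map.onV (f.map.onV i) = i := fun i =>
    congrFun (congrArg (fun h : QuiverOver.Hom X X => h.map.onV) e.hom_inv_id) i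
  have hfg : ∀ i, f.map.onV (g.map.onV i) = i := fun i =>
    congrFun (congrArg (fun h : QuiverOver.Hom Y Y => h.map.onV) e.inv_hom_id) i
  refine ⟨(QuiverRep.isoOfBijective (Hom.isCovering_of_iso e).restrict_mem_homs fun x =>
    Function.bijective_iff_has_inverse.2 ⟨g.restrict K x, fun p => ?_, fun p => ?_⟩).symm⟩
  · refine linearization_ext fun j => ?_
    rw [g.restrict_apply, Hom.restrict_apply]
    exact congrArg _ (Subtype.ext (hfg j.1))
  · refine linearization_ext fun j => ?_
    rw [Hom.restrict_apply, g.restrict_apply]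
    exact congrArg _ (Subtype.ext (hgf j.1))

/-! ### Linearizations of disjoint unions -/

/-- The inclusion of the first summand of a disjoint union. -/
def headInclusion {n : ℕ} (w : Fin (n + 1) → QuiverOver Q) :
    QuiverOver.Hom (w 0) (disjointUnion w) where
  map :=
    { onV := fun i => ⟨0, i⟩
      onE := fun a => ⟨0, a⟩
      s_onE := fun _ => rfl
      t_onE := fun _ => rfl }
  str_onV _ := rfl
  str_onE _ := rfl

/-- The inclusion of the other summands of a disjoint union. -/
def tailInclusion {n : ℕ} (w : Fin (n + 1) → QuiverOver Q) :
    QuiverOver.Hom (disjointUnion fun i : Fin n => w i.succ) (disjointUnion w) where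
  map :=
    { onV := fun i => ⟨i.1.succ, i.2⟩
      onE := fun a => ⟨a.1.succ, a.2⟩
      s_onE := fun _ => rfl
      t_onE := fun _ => rfl }
  str_onV _ := rfl
  str_onE _ := rfl

theorem headInclusion_isCovering {n : ℕ} (w : Fin (n + 1) → QuiverOver Q) :
    (headInclusion w).IsCovering := by
  intro j
  refine ⟨?_, ?_, ?_⟩
  · rintro b rfl
    rfl
  · intro b _ c _ h
    exact sigma_mk_injective (β := fun i => (w i).quiver.E) h
  · rintro ⟨i, c⟩ h
    obtain rfl : i = 0 := congrArg Sigma.fst h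
    exact ⟨c, sigma_mk_injective (β := fun i => (w i).quiver.V) h, rfl⟩

theorem tailInclusion_onV_injective {n : ℕ} (w : Fin (n + 1) → QuiverOver Q) :
    Function.Injective (tailInclusion w).map.onV := by
  rintro ⟨i, b⟩ ⟨j, c⟩ h
  obtain rfl : i = j := Fin.succ_injective n (congrArg Sigma.fst h)
  obtain rfl : b = c := sigma_mk_injective (β := fun i => (w i).quiver.V) h
  rfl

theorem tailInclusion_isCovering {n : ℕ} (w : Fin (n + 1) → QuiverOver Q) :
    (tailInclusion w).IsCovering := by
  intro j
  refine ⟨?_, ?_, ?_⟩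
  · rintro b rfl
    rfl
  · rintro ⟨i, b⟩ _ ⟨j, c⟩ _ h
    obtain rfl : i = j := Fin.succ_injective n (congrArg Sigma.fst h)
    obtain rfl : b = c := sigma_mk_injective (β := fun i => (w i).quiver.E) h
    rfl
  · rintro ⟨i, c⟩ h
    obtain rfl : i = j.1.succ := congrArg Sigma.fst h
    exact ⟨⟨j.1, c⟩, tailInclusion_onV_injective w h, rfl⟩

/-- A function on a disjoint union is the pair of its restrictions to the two parts; restriction
respects the arrows because both inclusions are coverings. -/
theorem linearization_disjointUnion_succ {n : ℕ} (w : Fin (n + 1) → QuiverOver Q) :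
    ((disjointUnion w).linearization K).IsIsomorphic (((w 0).linearization K).directSum
      ((disjointUnion fun i : Fin n => w i.succ).linearization K)) := by
  have hmem : (fun x => ((headInclusion w).restrict K x).prod ((tailInclusion w).restrict K x)) ∈
      QuiverRep.homs ((disjointUnion w).linearization K) (((w 0).linearization K).directSum
        ((disjointUnion fun i : Fin n => w i.succ).linearization K)) := fun a =>
    LinearMap.ext fun p => Prod.ext
      (QuiverRep.homs_apply (headInclusion_isCovering w).restrict_mem_homs a p)
      (QuiverRep.homs_apply (tailInclusion_isCovering w).restrict_mem_homs a p)
  refine ⟨QuiverRep.isoOfBijective hmem fun x => ⟨fun p q h => ?_, ?_⟩⟩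
  · refine linearization_ext ?_
    rintro ⟨⟨i, y⟩, hy⟩
    induction i using Fin.cases with
    | zero => exact congrFun (congrArg Prod.fst h) ⟨y, hy⟩
    | succ i => exact congrFun (congrArg Prod.snd h) ⟨⟨i, y⟩, hy⟩
  · rintro ⟨p, q⟩
    -- The index is kept apart from the vertex and the proof that it lies over `x`, so that
    -- `Fin.cases` can glue `p` and `q` and compute on each part.
    let F : ∀ (i : Fin (n + 1)) (y : (w i).quiver.V), (w i).str.onV y = x → K :=
      Fin.cases (fun y hy => linearizationEquiv K _ x p ⟨y, hy⟩)
        fun i y hy => linearizationEquiv K _ x q ⟨⟨i, y⟩, hy⟩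
    refine ⟨(linearizationEquiv K _ x).symm fun y => F y.1.1 y.1.2 y.2, ?_⟩
    exact Prod.ext rfl rfl

theorem toRepRing_linearization_disjointUnion {n : ℕ} (w : Fin n → QuiverOver Q) :
    ((disjointUnion w).linearization K).toRepRing = ∑ i, ((w i).linearization K).toRepRing := by
  induction n with
  | zero =>
    rw [Finset.univ_eq_empty, Finset.sum_empty]
    refine QuiverRep.IsZero.toRepRing_eq_zero fun x => ⟨fun p q => linearization_ext ?_⟩
    rintro ⟨⟨i, -⟩, -⟩
    exact i.elim0
  | succ n ih =>
    rw [QuiverRep.toRepRing_congr (linearization_disjointUnion_succ w),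
      QuiverRep.toRepRing_directSum, ih, Fin.sum_univ_succ]

/-! ### Linearizations of fiber products -/

/-- The fibers of a fiber product. -/
def fiberProductFiberEquiv (X Y : QuiverOver Q) (x : Q.V) :
    (X.fiberProduct Y).Fiber x ≃ X.Fiber x × Y.Fiber x where
  toFun z := (⟨z.1.1.1, z.2⟩, ⟨z.1.1.2, z.1.2.symm.trans z.2⟩)
  invFun z := ⟨⟨(z.1.1, z.2.1), z.1.2.trans z.2.2.symm⟩, z.1.2⟩
  left_inv _ := rfl
  right_inv _ := rfl

/-- The arrows of a fiber product ending at a given vertex. -/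
def fiberProductArrowsEquiv (X Y : QuiverOver Q) (a : Q.E) (j : (X.fiberProduct Y).quiver.V) :
    (X.fiberProduct Y).ArrowsTo a j ≃ X.ArrowsTo a j.1.1 × Y.ArrowsTo a j.1.2 where
  toFun b := (⟨b.1.1.1, b.2.1, congrArg (fun z => z.1.1) b.2.2⟩,
    ⟨b.1.1.2, b.1.2.symm.trans b.2.1, congrArg (fun z => z.1.2) b.2.2⟩)
  invFun b := ⟨⟨(b.1.1, b.2.1), b.1.2.1.trans b.2.2.1.symm⟩, b.1.2.1,
    Subtype.ext (Prod.ext b.1.2.2 b.2.2.2)⟩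
  left_inv _ := rfl
  right_inv _ := rfl

theorem finsum_mul_finsum_eq_finsum_prod {ι κ : Type*} [Finite ι] [Finite κ] (f : ι → K)
    (g : κ → K) : (∑ᶠ i, f i) * ∑ᶠ j, g j = ∑ᶠ b : ι × κ, f b.1 * g b.2 := by
  have := Fintype.ofFinite ι
  have := Fintype.ofFinite κ
  rw [finsum_eq_sum_of_fintype, finsum_eq_sum_of_fintype, finsum_eq_sum_of_fintype,
    Fintype.sum_prod_type, Finset.sum_mul_sum]

variable (K) in
/-- The space of the linearization of a fiber product at a vertex. -/
noncomputable def tensorLinearizationEquiv (X Y : QuiverOver Q) (x : Q.V) :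
    (X.linearization K).obj x ⊗[K] (Y.linearization K).obj x ≃ₗ[K]
      ((X.fiberProduct Y).linearization K).obj x :=
  (((Module.Basis.ofEquivFun (linearizationEquiv K X x)).tensorProduct
    (Module.Basis.ofEquivFun (linearizationEquiv K Y x))).equivFun.trans
      (LinearEquiv.funCongrLeft K K (fiberProductFiberEquiv X Y x))).trans
        (linearizationEquiv K (X.fiberProduct Y) x).symm

/-- Under the identification with functions, `p ⊗ q` is the function `(y, y') ↦ p y * q y'` on pairs
of points of the fibers. -/
theorem tensorLinearizationEquiv_tmul_apply (X Y : QuiverOver Q) (x : Q.V)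
    (p : (X.linearization K).obj x) (q : (Y.linearization K).obj x)
    (z : (X.fiberProduct Y).Fiber x) :
    linearizationEquiv K _ x (tensorLinearizationEquiv K X Y x (p ⊗ₜ q)) z =
      linearizationEquiv K X x p (fiberProductFiberEquiv X Y x z).1 *
        linearizationEquiv K Y x q (fiberProductFiberEquiv X Y x z).2 := by
  refine (Module.Basis.tensorProduct_repr_tmul_apply _ _ p q _ _).trans ?_
  rw [smul_eq_mul, mul_comm, Module.Basis.ofEquivFun_repr_apply,
    Module.Basis.ofEquivFun_repr_apply]
  rfl

/-- On pure tensors, the product of the two sums over incoming arrows expands into a sum over pairs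
of arrows over `a`, and these pairs are the incoming arrows of the fiber product. -/
theorem linearization_tensor (X Y : QuiverOver Q) :
    ((X.linearization K).tensor (Y.linearization K)).IsIsomorphic
      ((X.fiberProduct Y).linearization K) := by
  refine ⟨⟨tensorLinearizationEquiv K X Y, fun a m => ?_⟩⟩
  refine LinearMap.congr_fun (f := (tensorLinearizationEquiv K X Y (Q.t a)).toLinearMap ∘ₗ
      TensorProduct.map ((X.linearization K).map a) ((Y.linearization K).map a))
    (g := ((X.fiberProduct Y).linearization K).map a ∘ₗ
      (tensorLinearizationEquiv K X Y (Q.s a)).toLinearMap)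
    (TensorProduct.ext' fun p q => linearization_ext fun j => ?_) m
  rw [LinearMap.comp_apply, LinearMap.comp_apply, TensorProduct.map_tmul, LinearEquiv.coe_coe,
    LinearEquiv.coe_coe, tensorLinearizationEquiv_tmul_apply, linearizationEquiv_map_apply,
    linearizationEquiv_map_apply, linearizationEquiv_map_apply,
    finsum_mul_finsum_eq_finsum_prod]
  symm
  exact finsum_eq_of_bijective (fiberProductArrowsEquiv X Y a j.1) (Equiv.bijective _)
    fun b => tensorLinearizationEquiv_tmul_apply X Y _ p q _

end QuiverOver

/-! ### Counting morphisms -/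

namespace QuiverOver

variable {Q : FinQuiver.{u}}

/-- Morphisms to a fiber product are pairs of morphisms. -/
def homFiberProductEquiv (Z X Y : QuiverOver Q) :
    QuiverOver.Hom Z (X.fiberProduct Y) ≃ QuiverOver.Hom Z X × QuiverOver.Hom Z Y where
  toFun f :=
    ({ map :=
        { onV := fun i => (f.map.onV i).1.1
          onE := fun a => (f.map.onE a).1.1
          s_onE := fun a => congrArg (fun z => z.1.1) (f.map.s_onE a)
          t_onE := fun a => congrArg (fun z => z.1.1) (f.map.t_onE a) }
       str_onV := fun i => f.str_onV i
       str_onE := fun a => f.str_onE a },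
     { map :=
        { onV := fun i => (f.map.onV i).1.2
          onE := fun a => (f.map.onE a).1.2
          s_onE := fun a => congrArg (fun z => z.1.2) (f.map.s_onE a)
          t_onE := fun a => congrArg (fun z => z.1.2) (f.map.t_onE a) }
       str_onV := fun i => (f.map.onV i).2.symm.trans (f.str_onV i)
       str_onE := fun a => (f.map.onE a).2.symm.trans (f.str_onE a) })
  invFun g :=
    { map :=
        { onV := fun i => ⟨(g.1.map.onV i, g.2.map.onV i),
            (g.1.str_onV i).trans (g.2.str_onV i).symm⟩
          onE := fun a => ⟨(g.1.map.onE a, g.2.map.onE a),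
            (g.1.str_onE a).trans (g.2.str_onE a).symm⟩
          s_onE := fun a => Subtype.ext (Prod.ext (g.1.map.s_onE a) (g.2.map.s_onE a))
          t_onE := fun a => Subtype.ext (Prod.ext (g.1.map.t_onE a) (g.2.map.t_onE a)) }
      str_onV := fun i => g.1.str_onV i
      str_onE := fun a => g.1.str_onE a }
  left_inv _ := rfl
  right_inv _ := rfl

/-- The composition of a morphism with the inclusion of a summand of a disjoint union. -/
def homToDisjointUnion {n : ℕ} (w : Fin n → QuiverOver Q) {Z : QuiverOver Q} (i : Fin n)
    (f : QuiverOver.Hom Z (w i)) : QuiverOver.Hom Z (disjointUnion w) where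
  map :=
    { onV := fun j => ⟨i, f.map.onV j⟩
      onE := fun a => ⟨i, f.map.onE a⟩
      s_onE := fun a => congrArg (Sigma.mk i) (f.map.s_onE a)
      t_onE := fun a => congrArg (Sigma.mk i) (f.map.t_onE a) }
  str_onV j := f.str_onV j
  str_onE a := f.str_onE a

/-- A morphism from a connected quiver to a disjoint union factors uniquely through one of the
summands. -/
theorem bijective_homToDisjointUnion {n : ℕ} (w : Fin n → QuiverOver Q) {Z : QuiverOver Q}
    (hZ : Z.quiver.IsConnected) : Function.Bijective
      (fun f : Σ i, QuiverOver.Hom Z (w i) => homToDisjointUnion w f.1 f.2) := by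
  obtain ⟨⟨j₀⟩, hconn⟩ := hZ
  constructor
  · rintro ⟨i, f⟩ ⟨i', f'⟩ h
    have hV := congrArg (fun h : QuiverOver.Hom Z (disjointUnion w) => h.map.onV) h
    have hE := congrArg (fun h : QuiverOver.Hom Z (disjointUnion w) => h.map.onE) h
    -- The vertex `j₀` is essential: an empty quiver would map into every summand by the same map.
    obtain rfl : i = i' := congrArg Sigma.fst (congrFun hV j₀)
    refine congrArg (Sigma.mk i) (QuiverOver.Hom.ext (FinQuiver.Hom.ext ?_ ?_))
    · exact funext fun j => sigma_mk_injective (β := fun i => (w i).quiver.V) (congrFun hV j)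
    · exact funext fun a => sigma_mk_injective (β := fun i => (w i).quiver.E) (congrFun hE a)
  · intro f
    have hs : ∀ a, (f.map.onV (Z.quiver.s a)).1 = (f.map.onE a).1 := fun a =>
      (congrArg Sigma.fst (f.map.s_onE a)).symm
    have ht : ∀ a, (f.map.onV (Z.quiver.t a)).1 = (f.map.onE a).1 := fun a =>
      (congrArg Sigma.fst (f.map.t_onE a)).symm
    -- The summand index is constant along arrows, hence constant on the connected quiver.
    have hcomp : ∀ j j', Relation.EqvGen (fun p q => ∃ a, Z.quiver.s a = p ∧ Z.quiver.t a = q)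
        j j' → (f.map.onV j).1 = (f.map.onV j').1 := by
      intro j j' h
      induction h with
      | rel _ _ h =>
        obtain ⟨a, rfl, rfl⟩ := h
        exact (hs a).trans (ht a).symm
      | refl _ => rfl
      | symm _ _ _ ih => exact ih.symm
      | trans _ _ _ _ _ ih ih' => exact ih.trans ih'
    -- Stating the lifts to the summand of `j₀` as existence claims lets `choose` produce the
    -- factored map without transports.
    have hV : ∀ j, ∃ y : (w (f.map.onV j₀).1).quiver.V, f.map.onV j = ⟨_, y⟩ := by
      intro j
      rw [← hcomp j j₀ (hconn j j₀)]
      exact ⟨_, rfl⟩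
    have hE : ∀ a, ∃ y : (w (f.map.onV j₀).1).quiver.E, f.map.onE a = ⟨_, y⟩ := by
      intro a
      rw [← hcomp _ j₀ (hconn (Z.quiver.s a) j₀), hs]
      exact ⟨_, rfl⟩
    choose gV hgV using hV
    choose gE hgE using hE
    refine ⟨⟨_,
      { map :=
          { onV := gV
            onE := gE
            s_onE := fun a => ?_
            t_onE := fun a => ?_ }
        str_onV := fun j => ?_
        str_onE := fun a => ?_ }⟩, ?_⟩
    · have h := f.map.s_onE a
      rw [hgV, hgE] at h
      exact sigma_mk_injective (β := fun i => (w i).quiver.V) h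
    · have h := f.map.t_onE a
      rw [hgV, hgE] at h
      exact sigma_mk_injective (β := fun i => (w i).quiver.V) h
    · have h := f.str_onV j
      rw [hgV] at h
      exact h
    · have h := f.str_onE a
      rw [hgE] at h
      exact h
    · exact QuiverOver.Hom.ext (FinQuiver.Hom.ext (funext fun j => (hgV j).symm)
        (funext fun a => (hgE a).symm))

theorem card_hom_fiberProduct {n : ℕ} {w : Fin n → QuiverOver Q} {X Y Z : QuiverOver Q}
    (hZ : Z.quiver.IsConnected) (e : X.fiberProduct Y ≅ disjointUnion w) :
    Nat.card (Z ⟶ X) * Nat.card (Z ⟶ Y) = ∑ i, Nat.card (Z ⟶ w i) := by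
  rw [← Nat.card_prod, ← Nat.card_sigma,
    ← Nat.card_congr (show (Z ⟶ X.fiberProduct Y) ≃ (Z ⟶ X) × (Z ⟶ Y) from
      homFiberProductEquiv Z X Y),
    Nat.card_congr ((Iso.refl Z).homCongr e)]
  exact (Nat.card_congr (Equiv.ofBijective _ (bijective_homToDisjointUnion w hZ))).symm

end QuiverOver

theorem homCount_fullSubcategory {Q : FinQuiver.{u}} {C : ObjectProperty (QuiverOver Q)}
    (X Y : C.FullSubcategory) : homCount X Y = Nat.card (X.obj ⟶ Y.obj) :=
  Nat.card_congr InducedCategory.homEquiv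

/-! ### The linearization of the Möbius ring -/

section LinearizationMap

variable {K : Type u} [Field K] {Q : FinQuiver.{u}} {C : ObjectProperty (QuiverOver Q)}

theorem linearizationMap_of (X : C.FullSubcategory) :
    linearizationMap K C (MobiusRing.of X) = (X.obj.linearization K).toRepRing :=
  MobiusRing.lift_of _ X

/-- An element of the Möbius ring is the combination of objects given by its coefficients. -/
theorem MobiusRing.eq_sum_of {C : Type v} (a : MobiusRing C) :
    ∃ (s : Finset C) (c : C → ℤ), (∀ x, (show C →₀ ℤ from a) x ≠ 0 → x ∈ s) ∧
      (∀ x, c x = (show C →₀ ℤ from a) x) ∧ a = ∑ x ∈ s, c x • MobiusRing.of x := by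
  let a' : C →₀ ℤ := a
  refine ⟨a'.support, a', fun x => Finsupp.mem_support_iff.2, fun _ => rfl, ?_⟩
  refine (Finsupp.sum_single a').symm.trans (Finset.sum_congr rfl fun x _ => ?_)
  refine Eq.trans ?_ (Finsupp.smul_single _ _ _).symm
  rw [smul_eq_mul, mul_one]

/-- Pairwise non-isomorphic indecomposable linearizations are linearly independent. -/
theorem linearizationMap_injective (hind : ∀ X, C X → (X.linearization K).IsIndecomposable)
    (hniso : ∀ X Y, C X → C Y →
      (X.linearization K).IsIsomorphic (Y.linearization K) → X = Y) :
    Function.Injective (linearizationMap K C) := by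
  classical
  rw [injective_iff_map_eq_zero]
  intro a ha
  obtain ⟨s, c, hs, hc, hac⟩ := a.eq_sum_of
  refine Finsupp.ext (M := ℤ) (f := a) (g := 0) fun X => ?_
  rw [← hc]
  by_contra hX
  have hXs : X ∈ s := hs X (by rwa [← hc])
  -- Applied to the relation, `m` kills every term except that of `X`, leaving the coefficient of
  -- `X` times a positive integer.
  obtain ⟨m, hm⟩ := QuiverRep.exists_multiplicityHom (hind X.obj X.property)
  have h := congrArg m ha
  rw [hac, map_sum, map_sum, map_zero, Finset.sum_eq_single_of_mem X hXs, map_zsmul, map_zsmul,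
    linearizationMap_of, hm, smul_eq_mul, mul_eq_zero] at h
  · exact h.elim hX (QuiverRep.multiplicity_self_pos _).ne'
  · intro Y _ hYX
    rw [map_zsmul, map_zsmul, linearizationMap_of, hm,
      QuiverRep.multiplicity_eq_zero _ (hind Y.obj Y.property), smul_zero]
    intro h
    exact hYX (ObjectProperty.FullSubcategory.ext (hniso _ _ X.property Y.property h).symm)

variable [IsAcyclicCategory C.FullSubcategory] [IsLowerFinite C.FullSubcategory]

/-- By injectivity of `zeta` this may be checked at each object `Z` of the subcategory, where it is
the count of morphisms from the connected quiver `Z` to the fiber product. -/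
theorem MobiusRing.of_mul_of_eq_sum (hconn : ∀ X, C X → X.quiver.IsConnected)
    (X Y : C.FullSubcategory) {n : ℕ} {w : Fin n → C.FullSubcategory}
    (e : X.obj.fiberProduct Y.obj ≅ QuiverOver.disjointUnion fun i => (w i).obj) :
    MobiusRing.of X * MobiusRing.of Y = ∑ i, MobiusRing.of (w i) := by
  apply MobiusRing.zeta_injective
  ext Z
  rw [MobiusRing.zeta_mul, Finsupp.mul_apply, map_sum, Finsupp.finsetSum_apply]
  simp_rw [MobiusRing.zeta_of_apply, homCount_fullSubcategory]
  exact_mod_cast QuiverOver.card_hom_fiberProduct (hconn Z.obj Z.property) e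

theorem linearizationMap_of_mul_of (hconn : ∀ X, C X → X.quiver.IsConnected)
    (hprod : ClosedUnderFiberProducts C) (X Y : C.FullSubcategory) :
    linearizationMap K C (MobiusRing.of X * MobiusRing.of Y) =
      linearizationMap K C (MobiusRing.of X) * linearizationMap K C (MobiusRing.of Y) := by
  obtain ⟨n, w, hw, ⟨e⟩⟩ := hprod X.obj Y.obj X.property Y.property
  rw [MobiusRing.of_mul_of_eq_sum hconn X Y (w := fun i => ⟨w i, hw i⟩) e, map_sum]
  simp_rw [linearizationMap_of]
  rw [← QuiverRep.toRepRing_tensor,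
    QuiverRep.toRepRing_congr (QuiverOver.linearization_tensor X.obj Y.obj),
    QuiverRep.toRepRing_congr (QuiverOver.linearization_isIsomorphic_of_iso e),
    QuiverOver.toRepRing_linearization_disjointUnion]

theorem linearizationMap_mul (hconn : ∀ X, C X → X.quiver.IsConnected)
    (hprod : ClosedUnderFiberProducts C) (a b : MobiusRing C.FullSubcategory) :
    linearizationMap K C (a * b) = linearizationMap K C a * linearizationMap K C b := by
  obtain ⟨s, c, -, -, rfl⟩ := a.eq_sum_of
  obtain ⟨t, d, -, -, rfl⟩ := b.eq_sum_of
  simp only [Finset.sum_mul_sum, map_sum, smul_mul_smul_comm, map_zsmul,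
    linearizationMap_of_mul_of hconn hprod]

variable (K C) in
/-- The linearization as a ring homomorphism. -/
noncomputable def linearizationRingHom (hconn : ∀ X, C X → X.quiver.IsConnected)
    (hprod : ClosedUnderFiberProducts C) : MobiusRing C.FullSubcategory →ₙ+* RepRing K Q :=
  { linearizationMap K C with
    map_mul' := linearizationMap_mul hconn hprod }

/-- The range is a subring containing the generators, and each of its elements is an integer
combination of them; products are needed only through the multiplicativity of the map. -/
theorem range_linearizationRingHom (hconn : ∀ X, C X → X.quiver.IsConnected)
    (hprod : ClosedUnderFiberProducts C) :
    NonUnitalSubring.closure {r : RepRing K Q | ∃ X, C X ∧ r = (X.linearization K).toRepRing} =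
      NonUnitalRingHom.range (linearizationRingHom K C hconn hprod) := by
  apply le_antisymm
  · rw [NonUnitalSubring.closure_le]
    rintro _ ⟨X, hX, rfl⟩
    exact ⟨MobiusRing.of ⟨X, hX⟩, linearizationMap_of (C := C) ⟨X, hX⟩⟩
  · rintro _ ⟨a, rfl⟩
    change linearizationMap K C a ∈ _
    obtain ⟨s, c, -, -, rfl⟩ := a.eq_sum_of
    rw [map_sum]
    refine sum_mem fun X _ => ?_
    rw [map_zsmul, linearizationMap_of]
    refine zsmul_mem (NonUnitalSubring.subset_closure ?_) _
    exact ⟨X.obj, X.property, rfl⟩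

end LinearizationMap

theorem mainTheorem2 {K : Type u} [Field K] {Q : FinQuiver.{u}}
    (C : ObjectProperty (QuiverOver Q))
    [IsAcyclicCategory C.FullSubcategory] [IsLowerFinite C.FullSubcategory]
    (hconn : ∀ X, C X → X.quiver.IsConnected)
    (hwrap : ∀ X, C X → X.str.IsWrapping)
    (hprod : ClosedUnderFiberProducts C)
    (hind : ∀ X, C X → (X.linearization K).IsIndecomposable)
    (hniso : ∀ X Y, C X → C Y →
      (X.linearization K).IsIsomorphic (Y.linearization K) → X = Y) :
    (∃ φ : MobiusRing C.FullSubcategory →ₙ+* RepRing K Q,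
      (∀ a, φ a = linearizationMap K C a) ∧ Function.Injective φ) ∧
    (∃ e : MobiusRing C.FullSubcategory ≃+*
        NonUnitalSubring.closure
          {r : RepRing K Q | ∃ X, C X ∧ r = (X.linearization K).toRepRing},
      ∀ a, (e a : RepRing K Q) = linearizationMap K C a) := by
  have hinj := linearizationMap_injective (K := K) hind hniso
  refine ⟨⟨linearizationRingHom K C hconn hprod, fun a => rfl, hinj⟩, ?_⟩
  -- With the generated subring replaced by the range, the isomorphism is the injective map with
  -- restricted codomain.
  rw [range_linearizationRingHom hconn hprod]
  refine ⟨RingEquiv.ofBijective (linearizationRingHom K C hconn hprod).rangeRestrict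
    ⟨fun a b h => hinj (congrArg Subtype.val h), ?_⟩, fun a => rfl⟩
  rintro ⟨_, a, rfl⟩
  exact ⟨a, rfl⟩
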